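/- Let $n \in \mathbb{N}$, let $d = \lfloor 0.1n \rfloor$ (so $d = 0.1n$ when $10 \mid n$), and let $\mathbb{F}$ be a field whose characteristic is $0$ or greater than $d$. Let $r \le d$, and let $A_1,\dots,A_r,B_1,\dots,B_r,R \in \mathbb{F}[x_1,\dots,x_n]$ be polynomials such that $A_j(\mathbf{0}) = B_j(\mathbf{0}) = 0$ for every $j$ and $\deg R \le d-1$ (where $\deg 0 = -\infty$). An algebraic formula over $\mathbb{F}$ is a finite rooted tree whose leaves are labelled by variables $x_i$ or by constants from $\mathbb{F}$ and whose inner vertices are sum gates or product gates, of arbitrary finite fan-in; it computes the polynomial at its root. Its formal degree is defined inductively: it is $1$ for a variable, $0$ for a constant, the maximum of the formal degrees of the children for a sum gate, and the sum of the formal degrees of the children for a product gate. Then any algebraic formula over $\mathbb{F}$ of formal degree at most $d$ that computes the polynomial $$\sum_{S \subseteq [n],\ |S| = d}\ \prod_{i \in S} x_i \;+\; \sum_{j=1}^{r} A_j B_j \;+\; R$$ has at least $0.001\,n^2$ vertices. Moreover, if $n \ge 10$, then it has at least $0.001\,n^2$ leaves that are labelled by variables. -/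

import Mathlib

/-- Algebraic formulas over `F` in the variables `σ`: finite rooted trees whose leaves are labelled
by variables or by field constants and whose inner vertices are sum gates or product gates, of
arbitrary finite fan-in (formulas of fan-in two are the special case `k = 2` at every gate). -/
inductive AlgFormula (σ : Type*) (F : Type*) where
  | var (i : σ) : AlgFormula σ F
  | const (c : F) : AlgFormula σ F
  | add {k : ℕ} (child : Fin k → AlgFormula σ F) : AlgFormula σ F
  | mul {k : ℕ} (child : Fin k → AlgFormula σ F) : AlgFormula σ F

namespace AlgFormula

/-- The polynomial computed by a formula (at its root, the output gate). -/
noncomputable def toPoly {σ F : Type*} [CommSemiring F] : AlgFormula σ F → MvPolynomial σ F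
  | var i => MvPolynomial.X i
  | const c => MvPolynomial.C c
  | add child => ∑ j, (child j).toPoly
  | mul child => ∏ j, (child j).toPoly

/-- The formal degree of the root of a formula: `1` for a variable, `0` for a constant, the maximum
of the formal degrees of the children for a sum gate, their sum for a product gate. -/
def formalDegree {σ F : Type*} : AlgFormula σ F → ℕ
  | var _ => 1
  | const _ => 0
  | add child => Finset.univ.sup fun j => (child j).formalDegree
  | mul child => ∑ j, (child j).formalDegree

/-- The number of vertices (leaves and gates) of a formula. -/
def numVertices {σ F : Type*} : AlgFormula σ F → ℕ
  | var _ => 1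
  | const _ => 1
  | add child => 1 + ∑ j, (child j).numVertices
  | mul child => 1 + ∑ j, (child j).numVertices

/-- The number of leaves of a formula that are labelled by variables. -/
def numVarLeaves {σ F : Type*} : AlgFormula σ F → ℕ
  | var _ => 1
  | const _ => 0
  | add child => ∑ j, (child j).numVarLeaves
  | mul child => ∑ j, (child j).numVarLeaves

end AlgFormula

/-! Write `d + 1` for the degree. Repeatedly splitting off products whose first factor has degree
bound in `[m, 2m)`, `m ≈ d / 2`, turns the formula into `t` products plus a polynomial of degree at
most `d`, at a cost of `m` variable leaves per product. After constant terms are removed, `e_{d+1}`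
is a sum of `t + r` products `P * Q` of polynomials vanishing at the origin, plus a polynomial of
degree at most `d`. Let `I` be generated by all `P`, `Q` and `e₁, …, e_d`. Differentiating in `xᵢ`
gives `(-xᵢ) ^ d` modulo `I` on one side and a polynomial of degree below `d` on the other, so the
quotient by `I` is finite-dimensional. By Krull's height theorem `I` needs at least `n` generators:
`n ≤ 2 (t + r) + d`. Hence `t` is linear in `n`, and `t * m` is quadratic. -/

open MvPolynomial

/-- The `k`-th elementary symmetric polynomial in the variables of a finset `s`. -/
noncomputable def esymmOn {σ : Type*} (F : Type*) [CommSemiring F] (s : Finset σ) (k : ℕ) :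
    MvPolynomial σ F :=
  ∑ t ∈ s.powersetCard k, ∏ j ∈ t, X j

/-! ### Elementary symmetric polynomials and their derivatives -/

section esymm

variable {σ F : Type*}

lemma esymmOn_zero [CommSemiring F] (s : Finset σ) : esymmOn F s 0 = 1 := by
  simp [esymmOn]

lemma esymmOn_univ [CommSemiring F] [Fintype σ] (k : ℕ) :
    esymmOn F Finset.univ k = esymm σ F k := rfl

lemma esymmOn_insert_succ [CommSemiring F] [DecidableEq σ] {i : σ} {s : Finset σ} (h : i ∉ s)
    (k : ℕ) : esymmOn F (insert i s) (k + 1) = esymmOn F s (k + 1) + X i * esymmOn F s k := by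
  have hmem : ∀ t ∈ s.powersetCard k, i ∉ t := fun t ht hi =>
    h ((Finset.mem_powersetCard.1 ht).1 hi)
  unfold esymmOn
  rw [Finset.powersetCard_succ_insert h, Finset.sum_union, Finset.sum_image, Finset.mul_sum]
  · congr 1
    exact Finset.sum_congr rfl fun t ht => Finset.prod_insert (hmem t ht)
  · intro t ht u hu htu
    rw [← Finset.erase_insert (hmem t ht), ← Finset.erase_insert (hmem u hu), htu]
  · rw [Finset.disjoint_left]
    intro t ht ht'
    obtain ⟨u, -, rfl⟩ := Finset.mem_image.1 ht'
    exact h ((Finset.mem_powersetCard.1 ht).1 (Finset.mem_insert_self _ _))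

lemma pderiv_esymmOn_of_notMem [CommSemiring F] {i : σ} {s : Finset σ} (h : i ∉ s) (k : ℕ) :
    pderiv i (esymmOn F s k) = 0 := by
  unfold esymmOn
  rw [map_sum]
  refine Finset.sum_eq_zero fun t ht => ?_
  refine Finset.prod_induction _ (fun p => pderiv i p = 0)
    (fun p q hp hq => by rw [pderiv_mul, hp, hq, zero_mul, mul_zero, add_zero]) pderiv_one
    fun j hj => pderiv_X_of_ne ?_
  rintro rfl
  exact h ((Finset.mem_powersetCard.1 ht).1 hj)

lemma esymm_succ_eq [CommSemiring F] [Fintype σ] [DecidableEq σ] (i : σ) (k : ℕ) :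
    esymm σ F (k + 1) =
      esymmOn F (Finset.univ.erase i) (k + 1) + X i * esymmOn F (Finset.univ.erase i) k := by
  rw [← esymmOn_insert_succ (Finset.notMem_erase _ _), Finset.insert_erase (Finset.mem_univ _),
    esymmOn_univ]

lemma pderiv_esymm_succ [CommSemiring F] [Fintype σ] [DecidableEq σ] (i : σ) (k : ℕ) :
    pderiv i (esymm σ F (k + 1)) = esymmOn F (Finset.univ.erase i) k := by
  rw [esymm_succ_eq i, map_add, pderiv_mul,
    pderiv_esymmOn_of_notMem (Finset.notMem_erase _ _),
    pderiv_esymmOn_of_notMem (Finset.notMem_erase _ _), pderiv_X_self]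
  simp

/-- Modulo `e₁, …, eₖ`, the derivative of `eₖ₊₁` with respect to `xᵢ` is `(-xᵢ) ^ k`. -/
lemma pderiv_esymm_sub_mem [CommRing F] [Fintype σ] (I : Ideal (MvPolynomial σ F)) (i : σ)
    (k : ℕ) (h : ∀ j < k, esymm σ F (j + 1) ∈ I) :
    pderiv i (esymm σ F (k + 1)) - (-X i) ^ k ∈ I := by
  classical
  rw [pderiv_esymm_succ]
  induction k with
  | zero => simp [esymmOn_zero]
  | succ k ih =>
    -- With `xᵢ` removed, `e'_{k+1} = e_{k+1} - xᵢ e'_k`, which is `-xᵢ e'_k` modulo `I`.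
    have h1 := h k k.lt_succ_self
    rw [esymm_succ_eq i] at h1
    have h2 := I.mul_mem_left (X i) (ih fun j hj => h j (hj.trans k.lt_succ_self))
    convert I.sub_mem h1 h2 using 1
    ring

lemma eval_zero_esymm_succ [CommSemiring F] [Fintype σ] (k : ℕ) :
    eval 0 (esymm σ F (k + 1)) = 0 := by
  rw [esymm, map_sum]
  refine Finset.sum_eq_zero fun t ht => ?_
  rw [map_prod]
  obtain ⟨j, hj⟩ : t.Nonempty := by
    rw [← Finset.card_pos, (Finset.mem_powersetCard.1 ht).2]
    exact k.succ_pos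
  exact Finset.prod_eq_zero hj (by simp)

end esymm

/-! ### Finite quotients and Krull's height theorem -/

section commutativeAlgebra

variable {σ F : Type*}

lemma degree_lt_of_mem_support_pderiv [CommSemiring F] {p : MvPolynomial σ F} {d : ℕ}
    (hp : p.totalDegree ≤ d) {i : σ} {m : σ →₀ ℕ} (hm : m ∈ (pderiv i p).support) :
    m.degree < d := by
  rw [mem_support_iff, coeff_pderiv] at hm
  have h1 : m + Finsupp.single i 1 ∈ p.support := by
    rw [mem_support_iff]
    exact left_ne_zero_of_mul hm
  have h2 : (m + Finsupp.single i 1).degree ≤ p.totalDegree := le_totalDegree h1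
  rw [map_add, Finsupp.degree_single] at h2
  omega

/-- If an ideal contains, for every variable `xᵢ`, a polynomial with leading form a scalar multiple
of `xᵢ ^ N`, then the quotient by it is a finite-dimensional vector space. -/
lemma finite_quotient_of_X_pow_sub_mem [Field F] [Finite σ] (I : Ideal (MvPolynomial σ F)) (N : ℕ)
    (s : σ → MvPolynomial σ F) (hs : ∀ i, ∀ m ∈ (s i).support, m.degree < N)
    (hI : ∀ i, X i ^ N - s i ∈ I) : Module.Finite F (MvPolynomial σ F ⧸ I) := by
  classical
  have := Fintype.ofFinite σ
  let q : MvPolynomial σ F →ₐ[F] MvPolynomial σ F ⧸ I := Ideal.Quotient.mkₐ F I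
  let T : Finset (σ →₀ ℕ) := Finset.Iic (Finsupp.equivFunOnFinite.symm fun _ => N)
  let V : Submodule F (MvPolynomial σ F ⧸ I) :=
    Submodule.span F ((T.image fun m => q (monomial m 1) : Finset _) : Set (MvPolynomial σ F ⧸ I))
  have hpoly : ∀ p : MvPolynomial σ F, (∀ m ∈ p.support, q (monomial m 1) ∈ V) → q p ∈ V := by
    intro p hp
    rw [p.as_sum, map_sum]
    refine V.sum_mem fun m hm => ?_
    have : monomial m (coeff m p) = coeff m p • monomial m (1 : F) := by
      rw [smul_monomial, smul_eq_mul, mul_one]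
    rw [this, map_smul]
    exact V.smul_mem _ (hp m hm)
  have hmon : ∀ (D : ℕ) (m : σ →₀ ℕ), m.degree = D → q (monomial m 1) ∈ V := by
    intro D
    induction D using Nat.strong_induction_on with
    | _ D ih =>
    intro m hm
    -- Replacing `xᵢ ^ N` by `s i` strictly lowers the degree; irreducible monomials lie in the
    -- finite box `T`.
    by_cases h : ∃ i, N ≤ m i
    · obtain ⟨i, hi⟩ := h
      obtain ⟨m', rfl⟩ : ∃ m', m = m' + Finsupp.single i N :=
        ⟨m - Finsupp.single i N, (tsub_add_cancel_of_le (by simpa using hi)).symm⟩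
      have h1 : q (monomial (m' + Finsupp.single i N) 1) = q (monomial m' 1 * s i) := by
        refine Ideal.Quotient.eq.2 ?_
        have : (monomial (m' + Finsupp.single i N) (1 : F)) = monomial m' 1 * X i ^ N := by
          rw [X_pow_eq_monomial, monomial_mul, one_mul]
        rw [this, ← mul_sub]
        exact I.mul_mem_left _ (hI i)
      rw [h1]
      refine hpoly _ fun u hu => ?_
      obtain ⟨v, hv, w, hw, rfl⟩ := Finset.mem_add.1 (support_mul _ _ hu)
      refine ih _ ?_ _ rfl
      have hv' : v = m' := by
        simpa using support_monomial_subset hv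
      have := hs i w hw
      rw [map_add, Finsupp.degree_single] at hm
      rw [map_add, hv']
      omega
    · push Not at h
      refine Submodule.subset_span ?_
      rw [Finset.mem_coe]
      refine Finset.mem_image_of_mem _ ?_
      rw [Finset.mem_Iic]
      intro i
      simpa using (h i).le
  refine ⟨⟨T.image fun m => q (monomial m 1), ?_⟩⟩
  rw [eq_top_iff]
  rintro x -
  obtain ⟨p, rfl⟩ := Ideal.Quotient.mk_surjective x
  exact hpoly p fun m _ => hmon _ m rfl

/-- The kernel of the substitution of zero for the variables with index below `k`. -/
noncomputable def initialVariablesIdeal (F : Type*) [Field F] (n k : ℕ) :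
    Ideal (MvPolynomial (Fin n) F) :=
  RingHom.ker (aeval fun j : Fin n => if j.val < k then 0 else X j :
    MvPolynomial (Fin n) F →ₐ[F] MvPolynomial (Fin n) F)

instance initialVariablesIdeal_isPrime [Field F] (n k : ℕ) :
    (initialVariablesIdeal F n k).IsPrime :=
  RingHom.ker_isPrime _

lemma initialVariablesIdeal_lt_succ [Field F] {n k : ℕ} (hk : k < n) :
    initialVariablesIdeal F n k < initialVariablesIdeal F n (k + 1) := by
  refine lt_of_le_of_ne ?_ ?_
  · intro p hp
    have hcomp : (aeval fun j : Fin n => if j.val < k + 1 then 0 else X j :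
        MvPolynomial (Fin n) F →ₐ[F] MvPolynomial (Fin n) F) =
        (aeval fun j : Fin n => if j.val < k + 1 then 0 else X j).comp
          (aeval fun j : Fin n => if j.val < k then 0 else X j) := by
      ext1 j
      simp only [aeval_X, AlgHom.comp_apply]
      split_ifs with h1 h2 h2
      · simp
      · rw [aeval_X, if_pos h1]
      · omega
      · rw [aeval_X, if_neg h1]
    rw [initialVariablesIdeal, RingHom.mem_ker] at hp ⊢
    rw [hcomp, AlgHom.comp_apply, hp, map_zero]
  · intro h
    have h1 : (X ⟨k, hk⟩ : MvPolynomial (Fin n) F) ∈ initialVariablesIdeal F n (k + 1) := by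
      simp [initialVariablesIdeal, RingHom.mem_ker]
    rw [← h, initialVariablesIdeal, RingHom.mem_ker] at h1
    simp at h1

/-- The ideals `(x₀, …, x_{j-1})`, `j ≤ k`, form a strict chain of primes. -/
lemma le_height_initialVariablesIdeal [Field F] {n k : ℕ} (hk : k ≤ n) :
    (k : ℕ∞) ≤ (initialVariablesIdeal F n k).height := by
  induction k with
  | zero => simp
  | succ k ih =>
    refine le_trans ?_
      (Ideal.height_add_one_le_of_lt_of_isPrime (initialVariablesIdeal_lt_succ hk))
    push_cast
    gcongr
    exact ih (by omega)

lemma initialVariablesIdeal_self [Field F] (n : ℕ) :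
    initialVariablesIdeal F n n = RingHom.ker (eval (0 : Fin n → F)) := by
  have h : ∀ p : MvPolynomial (Fin n) F,
      (aeval fun j : Fin n => if j.val < n then 0 else X j :
        MvPolynomial (Fin n) F →ₐ[F] MvPolynomial (Fin n) F) p = C (eval 0 p) := by
    intro p
    have : (fun j : Fin n => if j.val < n then 0 else X j : Fin n → MvPolynomial (Fin n) F) = 0 := by
      ext1 j
      simp
    rw [this, aeval_zero]
    simp [MvPolynomial.algebraMap_eq]
  ext p
  rw [initialVariablesIdeal, RingHom.mem_ker, RingHom.mem_ker, h, C_eq_zero]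

lemma le_height_ker_eval_zero [Field F] (n : ℕ) :
    (n : ℕ∞) ≤ (RingHom.ker (eval (0 : Fin n → F))).height := by
  rw [← initialVariablesIdeal_self]
  exact le_height_initialVariablesIdeal le_rfl

/-- Finitely many polynomials that vanish at the origin and span an ideal with finite-dimensional
quotient are at least as many as the variables. -/
lemma le_card_of_finite_quotient [Field F] {n : ℕ} (s : Finset (MvPolynomial (Fin n) F))
    (h0 : ∀ p ∈ s, eval 0 p = 0)
    [Module.Finite F (MvPolynomial (Fin n) F ⧸ Ideal.span (s : Set (MvPolynomial (Fin n) F)))] :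
    n ≤ s.card := by
  set I := Ideal.span (s : Set (MvPolynomial (Fin n) F)) with hI
  have hle : I ≤ RingHom.ker (eval (0 : Fin n → F)) := by
    rw [hI, Ideal.span_le]
    exact fun p hp => h0 p hp
  have : (RingHom.ker (eval (0 : Fin n → F))).IsPrime := RingHom.ker_isPrime _
  obtain ⟨p, hp, hple⟩ := Ideal.exists_minimalPrimes_le hle
  have hpp : p.IsPrime := hp.1.1
  have hfin : Module.Finite F (MvPolynomial (Fin n) F ⧸ p) :=
    Module.Finite.of_surjective (Ideal.Quotient.factorₐ F hp.1.2).toLinearMap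
      (Ideal.Quotient.factor_surjective hp.1.2)
  -- A finite-dimensional domain over a field is a field, so `p` is the ideal of the origin, of
  -- height at least `n`.
  have hmax : p.IsMaximal := by
    apply Ideal.Quotient.maximal_of_isField
    exact isField_of_isIntegral_of_isField' (R := F) (Field.toIsField F)
  have heq := hmax.eq_of_le this.ne_top hple
  have h1 := Ideal.height_le_card_of_mem_minimalPrimes_span_finset hp
  rw [heq] at h1
  exact_mod_cast (le_height_ker_eval_zero n).trans h1

end commutativeAlgebra

/-! ### Lower bound on the number of products -/

/-- If `e_{k+1}` is, up to a polynomial of degree at most `k`, a sum of products of pairs of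
polynomials vanishing at the origin, then there are at least `(n - k) / 2` such pairs. -/
theorem le_two_mul_card_add_of_esymm_eq {F : Type*} [Field F] {n k : ℕ} {ι : Type*} [Fintype ι]
    (P Q : ι → MvPolynomial (Fin n) F) (R : MvPolynomial (Fin n) F)
    (hP : ∀ j, eval 0 (P j) = 0) (hQ : ∀ j, eval 0 (Q j) = 0) (hR : R.totalDegree ≤ k)
    (h : esymm (Fin n) F (k + 1) = ∑ j, P j * Q j + R) : n ≤ 2 * Fintype.card ι + k := by
  classical
  let s : Finset (MvPolynomial (Fin n) F) :=
    Finset.univ.image P ∪ Finset.univ.image Q ∪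
      (Finset.range k).image fun j => esymm (Fin n) F (j + 1)
  let I := Ideal.span (s : Set (MvPolynomial (Fin n) F))
  have hs : ∀ p ∈ s, p ∈ I := fun p hp => Ideal.subset_span hp
  have hPI : ∀ j, P j ∈ I := fun j => hs _ (by simp [s])
  have hQI : ∀ j, Q j ∈ I := fun j => hs _ (by simp [s])
  have hEI : ∀ j < k, esymm (Fin n) F (j + 1) ∈ I := fun j hj =>
    hs _ (Finset.mem_union_right _
      (Finset.mem_image_of_mem (fun j => esymm (Fin n) F (j + 1)) (Finset.mem_range.2 hj)))
  have hfin : Module.Finite F (MvPolynomial (Fin n) F ⧸ I) := by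
    -- Modulo `I`, `(-xᵢ) ^ k ≡ ∂ᵢ e_{k+1} ≡ ∂ᵢ R`, as the product rule puts each `∂ᵢ (P j * Q j)`
    -- in `I`.
    refine finite_quotient_of_X_pow_sub_mem I k (fun i => C ((-1) ^ k) * pderiv i R) ?_ ?_
    · intro i m hm
      refine degree_lt_of_mem_support_pderiv hR (i := i) ?_
      rw [C_mul'] at hm
      exact support_smul hm
    · intro i
      have h1 := pderiv_esymm_sub_mem I i k hEI
      have h2 : pderiv i (∑ j, P j * Q j) ∈ I := by
        rw [map_sum]
        refine I.sum_mem fun j _ => ?_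
        rw [pderiv_mul]
        exact I.add_mem (I.mul_mem_left _ (hQI j)) (I.mul_mem_right _ (hPI j))
      rw [h, map_add] at h1
      have h3 := I.mul_mem_left (C ((-1) ^ k)) (I.sub_mem h2 h1)
      convert h3 using 1
      have h4 : (-X i : MvPolynomial (Fin n) F) ^ k = C ((-1) ^ k) * X i ^ k := by
        rw [neg_pow]
        simp
      have h5 : (C ((-1) ^ k) : MvPolynomial (Fin n) F) * C ((-1) ^ k) = 1 := by
        rw [← C_mul, ← mul_pow]
        simp
      rw [h4]
      linear_combination (-(X i ^ k : MvPolynomial (Fin n) F)) * h5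
  have hcard : n ≤ s.card := by
    refine le_card_of_finite_quotient s fun p hp => ?_
    simp only [s, Finset.mem_union, Finset.mem_image] at hp
    rcases hp with (⟨j, -, rfl⟩ | ⟨j, -, rfl⟩) | ⟨j, -, rfl⟩
    · exact hP j
    · exact hQ j
    · exact eval_zero_esymm_succ j
  have h1 : s.card ≤ Fintype.card ι + Fintype.card ι + k := by
    refine (Finset.card_union_le _ _).trans (add_le_add ((Finset.card_union_le _ _).trans
      (add_le_add Finset.card_image_le Finset.card_image_le)) (Finset.card_image_le.trans ?_))
    simp
  omega

/-! ### Decomposition of formulas into products -/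

namespace AlgFormula

variable {σ F : Type*}

lemma formalDegree_le_numVarLeaves (Φ : AlgFormula σ F) : Φ.formalDegree ≤ Φ.numVarLeaves := by
  induction Φ with
  | var i => simp [formalDegree, numVarLeaves]
  | const c => simp [formalDegree, numVarLeaves]
  | add child ih =>
    refine Finset.sup_le fun j _ => (ih j).trans ?_
    exact Finset.single_le_sum (f := fun j => (child j).numVarLeaves) (fun _ _ => Nat.zero_le _)
      (Finset.mem_univ j)
  | mul child ih => exact Finset.sum_le_sum fun j _ => ih j

lemma numVarLeaves_le_numVertices (Φ : AlgFormula σ F) : Φ.numVarLeaves ≤ Φ.numVertices := by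
  induction Φ with
  | var i => simp [numVertices, numVarLeaves]
  | const c => simp [numVertices, numVarLeaves]
  | add child ih => exact (Finset.sum_le_sum fun j _ => ih j).trans (Nat.le_add_left _ _)
  | mul child ih => exact (Finset.sum_le_sum fun j _ => ih j).trans (Nat.le_add_left _ _)

lemma numVertices_pos (Φ : AlgFormula σ F) : 0 < Φ.numVertices := by
  cases Φ <;> simp [numVertices]

lemma totalDegree_toPoly_le [CommSemiring F] (Φ : AlgFormula σ F) :
    Φ.toPoly.totalDegree ≤ Φ.formalDegree := by
  induction Φ with
  | var i =>
    exact (totalDegree_monomial_le _ _).trans (by simp [formalDegree])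
  | const c => simp [toPoly, formalDegree]
  | add child ih =>
    exact totalDegree_finsetSum_le fun j _ => (ih j).trans
      (Finset.le_sup (f := fun j => (child j).formalDegree) (Finset.mem_univ j))
  | mul child ih =>
    exact (totalDegree_finsetProd _ _).trans (Finset.sum_le_sum fun j _ => ih j)

/-- A family of numbers below `m` whose sum is at least `m` has a subfamily with sum in
`[m, 2m)`. -/
lemma exists_subset_sum_mem_Ico {ι : Type*} (f : ι → ℕ) {m : ℕ} (hm : 1 ≤ m) (s : Finset ι)
    (hf : ∀ j ∈ s, f j < m) (hs : m ≤ ∑ j ∈ s, f j) :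
    ∃ t ⊆ s, m ≤ ∑ j ∈ t, f j ∧ ∑ j ∈ t, f j < 2 * m := by
  classical
  induction s using Finset.induction_on with
  | empty => exact ⟨∅, le_rfl, hs, by simp; omega⟩
  | insert a s ha ih =>
    by_cases h : m ≤ ∑ j ∈ s, f j
    · obtain ⟨t, hts, ht⟩ := ih (fun j hj => hf j (Finset.mem_insert_of_mem hj)) h
      exact ⟨t, hts.trans (Finset.subset_insert _ _), ht⟩
    · refine ⟨insert a s, le_rfl, hs, ?_⟩
      have := hf a (Finset.mem_insert_self _ _)
      rw [Finset.sum_insert ha]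
      omega

/-- A formula of formal degree at least `m` is the sum of a product, one factor of which has degree
in `[m, 2m)`, and a formula with at least `m` variable leaves fewer. -/
lemma exists_eq_mul_add [CommSemiring F] {m : ℕ} (hm : 1 ≤ m) (Φ : AlgFormula σ F)
    (hΦ : m ≤ Φ.formalDegree) :
    ∃ (P Q : MvPolynomial σ F) (Ψ : AlgFormula σ F) (a b : ℕ),
      Φ.toPoly = P * Q + Ψ.toPoly ∧ P.totalDegree ≤ a ∧ Q.totalDegree ≤ b ∧ m ≤ a ∧ a < 2 * m ∧
      a + b ≤ Φ.formalDegree ∧ Ψ.formalDegree ≤ Φ.formalDegree ∧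
      Ψ.numVarLeaves + m ≤ Φ.numVarLeaves := by
  classical
  induction Φ with
  | var i =>
    simp only [formalDegree] at hΦ
    refine ⟨X i, 1, const 0, 1, 0, by simp [toPoly], (var i).totalDegree_toPoly_le, by simp, hΦ,
      by omega, le_rfl, by simp [formalDegree], ?_⟩
    simpa [numVarLeaves] using hΦ
  | const c => simp only [formalDegree] at hΦ; omega
  | @add k child ih =>
    obtain ⟨j, -, hj⟩ := (Finset.le_sup_iff (by rw [Nat.bot_eq_zero]; omega)).1 hΦ
    obtain ⟨P, Q, Ψ, a, b, h, hP, hQ, hma, ham, hab, hdeg, hleaves⟩ := ih j hj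
    have hsup : ∀ i, (child i).formalDegree ≤ (add child).formalDegree := fun i =>
      Finset.le_sup (f := fun j => (child j).formalDegree) (Finset.mem_univ i)
    refine ⟨P, Q, add (Function.update child j Ψ), a, b, ?_, hP, hQ, hma, ham,
      hab.trans (hsup j), ?_, ?_⟩
    · simp only [toPoly]
      rw [← Finset.add_sum_erase _ _ (Finset.mem_univ j),
        ← Finset.add_sum_erase (a := j) _ (fun i => (Function.update child j Ψ i).toPoly)
          (Finset.mem_univ j), Function.update_self, h, add_assoc]
      congr 2
      refine Finset.sum_congr rfl fun i hi => ?_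
      rw [Function.update_of_ne (Finset.ne_of_mem_erase hi)]
    · refine Finset.sup_le fun i _ => ?_
      rcases eq_or_ne i j with rfl | hi
      · rw [Function.update_self]
        exact hdeg.trans (hsup i)
      · rw [Function.update_of_ne hi]
        exact hsup i
    · simp only [numVarLeaves]
      rw [← Finset.add_sum_erase _ _ (Finset.mem_univ j),
        ← Finset.add_sum_erase (a := j) _ (fun i => (child i).numVarLeaves)
          (Finset.mem_univ j), Function.update_self,
        Finset.sum_congr rfl (g := fun i => (child i).numVarLeaves) fun i hi => by
          rw [Function.update_of_ne (Finset.ne_of_mem_erase hi)]]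
      omega
  | @mul k child ih =>
    -- If a child is large, descend into it and let `Q` absorb its siblings; otherwise group small
    -- children into a factor of the right degree, leaving remainder zero.
    by_cases hbig : ∃ j, m ≤ (child j).formalDegree
    · obtain ⟨j, hj⟩ := hbig
      obtain ⟨P, Q, Ψ, a, b, h, hP, hQ, hma, ham, hab, hdeg, hleaves⟩ := ih j hj
      have hupd : ∀ i ∈ Finset.univ.erase j, Function.update child j Ψ i = child i :=
        fun i hi => Function.update_of_ne (Finset.ne_of_mem_erase hi) _ _
      refine ⟨P, Q * ∏ i ∈ Finset.univ.erase j, (child i).toPoly, mul (Function.update child j Ψ),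
        a, b + ∑ i ∈ Finset.univ.erase j, (child i).formalDegree, ?_, hP, ?_, hma, ham, ?_, ?_, ?_⟩
      · simp only [toPoly]
        rw [← Finset.mul_prod_erase _ _ (Finset.mem_univ j),
          ← Finset.mul_prod_erase (a := j) _ (fun i => (Function.update child j Ψ i).toPoly)
            (Finset.mem_univ j), Function.update_self, h,
          Finset.prod_congr rfl (f := fun i => (Function.update child j Ψ i).toPoly)
            (g := fun i => (child i).toPoly) fun i hi => by rw [hupd i hi]]
        ring
      · refine (totalDegree_mul _ _).trans (add_le_add hQ ((totalDegree_finsetProd _ _).trans ?_))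
        exact Finset.sum_le_sum fun i _ => (child i).totalDegree_toPoly_le
      · simp only [formalDegree]
        rw [← Finset.add_sum_erase _ _ (Finset.mem_univ j)]
        omega
      · simp only [formalDegree]
        rw [← Finset.add_sum_erase _ _ (Finset.mem_univ j),
          ← Finset.add_sum_erase (a := j) _ (fun i => (child i).formalDegree) (Finset.mem_univ j),
          Function.update_self,
          Finset.sum_congr rfl (g := fun i => (child i).formalDegree) fun i hi => by
            rw [hupd i hi]]
        omega
      · simp only [numVarLeaves]
        rw [← Finset.add_sum_erase _ _ (Finset.mem_univ j),
          ← Finset.add_sum_erase (a := j) _ (fun i => (child i).numVarLeaves) (Finset.mem_univ j),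
          Function.update_self,
          Finset.sum_congr rfl (g := fun i => (child i).numVarLeaves) fun i hi => by
            rw [hupd i hi]]
        omega
    · push Not at hbig
      obtain ⟨t, -, hmt, htm⟩ := exists_subset_sum_mem_Ico (fun j => (child j).formalDegree) hm
        Finset.univ (fun j _ => hbig j) hΦ
      have hprod : ∀ u : Finset (Fin k), (∏ j ∈ u, (child j).toPoly).totalDegree ≤
          ∑ j ∈ u, (child j).formalDegree := fun u =>
        (totalDegree_finsetProd _ _).trans
          (Finset.sum_le_sum fun i _ => (child i).totalDegree_toPoly_le)
      refine ⟨∏ j ∈ t, (child j).toPoly, ∏ j ∈ tᶜ, (child j).toPoly, const 0, _, _, ?_,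
        hprod t, hprod tᶜ, hmt, htm, ?_, ?_, ?_⟩
      · simp [toPoly, Finset.prod_mul_prod_compl]
      · exact (Finset.sum_add_sum_compl t _).le
      · simp [formalDegree]
      · have := (mul child).formalDegree_le_numVarLeaves
        simp only [numVarLeaves] at this ⊢
        omega

/-- A product of two polynomials of degree at most `d` splits into
a product of polynomials vanishing at the origin and a remainder of degree at most `d`. -/
lemma exists_mul_eq_mul_add [CommRing F] {d : ℕ} {P Q : MvPolynomial σ F}
    (hP : P.totalDegree ≤ d) (hQ : Q.totalDegree ≤ d) :
    ∃ P' Q' R' : MvPolynomial σ F, P * Q = P' * Q' + R' ∧ eval 0 P' = 0 ∧ eval 0 Q' = 0 ∧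
      R'.totalDegree ≤ d := by
  refine ⟨P - C (eval 0 P), Q - C (eval 0 Q),
    C (eval 0 P) * Q + (C (eval 0 Q) * P - C (eval 0 P * eval 0 Q)), ?_, by simp, by simp, ?_⟩
  · rw [C_mul]
    ring
  · have hC : ∀ (c : F) (p : MvPolynomial σ F), p.totalDegree ≤ d → (C c * p).totalDegree ≤ d :=
      fun c p hp => (totalDegree_mul _ _).trans (by simpa using hp)
    refine (totalDegree_add _ _).trans (max_le (hC _ _ hQ) ((totalDegree_sub _ _).trans
      (max_le (hC _ _ hP) ?_)))
    rw [totalDegree_C]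
    exact Nat.zero_le d

/-- A formula of formal degree at most `d + 1` computes, up to a polynomial of degree at most `d`, a
sum of few products of pairs of polynomials vanishing at the origin. -/
lemma exists_eq_sum_mul_add [CommRing F] {d m : ℕ} (hm : 1 ≤ m) (hmd : 2 * m ≤ d + 1)
    (Φ : AlgFormula σ F) (hΦ : Φ.formalDegree ≤ d + 1) :
    ∃ (t : ℕ) (P Q : Fin t → MvPolynomial σ F) (R : MvPolynomial σ F),
      Φ.toPoly = ∑ j, P j * Q j + R ∧ (∀ j, eval 0 (P j) = 0) ∧ (∀ j, eval 0 (Q j) = 0) ∧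
      R.totalDegree ≤ d ∧ t * m ≤ Φ.numVarLeaves := by
  induction hN : Φ.numVarLeaves using Nat.strong_induction_on generalizing Φ with
  | _ N ih =>
  subst hN
  by_cases hd : Φ.formalDegree ≤ d
  · exact ⟨0, Fin.elim0, Fin.elim0, Φ.toPoly, by simp, fun j => j.elim0, fun j => j.elim0,
      Φ.totalDegree_toPoly_le.trans hd, by simp⟩
  · obtain ⟨P, Q, Ψ, a, b, h, hP, hQ, hma, ham, hab, hdeg, hleaves⟩ :=
      Φ.exists_eq_mul_add hm (by omega)
    -- `a < 2 * m ≤ d + 1` bounds `a`; `1 ≤ m ≤ a` and `a + b ≤ d + 1` bound `b`.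
    obtain ⟨P', Q', R', h', hP', hQ', hR'⟩ :=
      exists_mul_eq_mul_add (hP.trans (by omega : a ≤ d)) (hQ.trans (by omega : b ≤ d))
    obtain ⟨t, p, q, R, hsum, hp, hq, hR, ht⟩ :=
      ih Ψ.numVarLeaves (by omega) Ψ (hdeg.trans hΦ) rfl
    refine ⟨t + 1, Fin.cons P' p, Fin.cons Q' q, R' + R, ?_, ?_, ?_, ?_, ?_⟩
    · rw [h, h', hsum, Fin.sum_univ_succ]
      simp only [Fin.cons_zero, Fin.cons_succ]
      ring
    · exact Fin.cases hP' hp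
    · exact Fin.cases hQ' hq
    · exact (totalDegree_add _ _).trans (max_le hR' hR)
    · rw [add_mul, one_mul]
      omega

end AlgFormula

/-! ### Leaf bounds and the final count -/

/-- A formula of formal degree at most `d + 1` for a perturbation of `e_{d+1}` has at least
`(n - d - 2r) m / 2` variable leaves, whenever `2 m ≤ d + 1`. -/
theorem AlgFormula.le_numVarLeaves_of_toPoly_eq {F : Type*} [Field F] {n d m r : ℕ} (hm : 1 ≤ m)
    (hmd : 2 * m ≤ d + 1) (A B : Fin r → MvPolynomial (Fin n) F) (R : MvPolynomial (Fin n) F)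
    (hA : ∀ j, eval 0 (A j) = 0) (hB : ∀ j, eval 0 (B j) = 0) (hR : R.totalDegree ≤ d)
    (Φ : AlgFormula (Fin n) F) (hdeg : Φ.formalDegree ≤ d + 1)
    (hΦ : Φ.toPoly = esymm (Fin n) F (d + 1) + ∑ j, A j * B j + R) :
    ∃ t, n ≤ 2 * (t + r) + d ∧ t * m ≤ Φ.numVarLeaves := by
  obtain ⟨t, P, Q, S, h, hP, hQ, hS, ht⟩ := Φ.exists_eq_sum_mul_add hm hmd hdeg
  refine ⟨t, ?_, ht⟩
  have := le_two_mul_card_add_of_esymm_eq (ι := Fin t ⊕ Fin r) (Sum.elim P fun j => -A j)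
    (Sum.elim Q B) (S - R) (k := d) (Sum.rec hP fun j => by simpa using hA j)
    (Sum.rec hQ hB) ((totalDegree_sub _ _).trans (max_le hS hR)) (by
      rw [h] at hΦ
      simp only [Fintype.sum_sum_type, Sum.elim_inl, Sum.elim_inr, neg_mul,
        Finset.sum_neg_distrib]
      linear_combination -hΦ)
  simpa using this

/-- A formula for a perturbation of `e_{d+1}` by few products has formal degree above `d`. -/
theorem AlgFormula.lt_formalDegree_of_toPoly_eq {F : Type*} [Field F] {n d r : ℕ}
    (hn : 2 * r + d < n) (A B : Fin r → MvPolynomial (Fin n) F) (R : MvPolynomial (Fin n) F)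
    (hA : ∀ j, eval 0 (A j) = 0) (hB : ∀ j, eval 0 (B j) = 0) (hR : R.totalDegree ≤ d)
    (Φ : AlgFormula (Fin n) F)
    (hΦ : Φ.toPoly = esymm (Fin n) F (d + 1) + ∑ j, A j * B j + R) : d < Φ.formalDegree := by
  by_contra! hdeg
  -- The whole formula would count as low-degree remainder.
  have := le_two_mul_card_add_of_esymm_eq (fun j => -A j) B (Φ.toPoly - R) (k := d)
    (by simpa using hA) hB
    ((totalDegree_sub _ _).trans (max_le (Φ.totalDegree_toPoly_le.trans hdeg) hR)) (by
      simp only [neg_mul, Finset.sum_neg_distrib]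
      linear_combination -hΦ)
  rw [Fintype.card_fin] at this
  omega

-- `n / 10` is the integer part of `0.1 n`, which is `0.1 n` itself if `10` divides `n`.
-- A field of characteristic zero counts as one of large characteristic.
-- The zero polynomial has degree `-∞`, hence the alternative `R = 0` (it matters only if `n < 10`).
theorem theorem5p9 (n : ℕ) (F : Type*) [Field F]
    (hF : ringChar F = 0 ∨ n / 10 < ringChar F)
    (r : ℕ) (hr : r ≤ n / 10)
    (A B : Fin r → MvPolynomial (Fin n) F) (R : MvPolynomial (Fin n) F)
    (hA : ∀ j, MvPolynomial.eval 0 (A j) = 0)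
    (hB : ∀ j, MvPolynomial.eval 0 (B j) = 0)
    (hR : R = 0 ∨ R.totalDegree + 1 ≤ n / 10)
    (Φ : AlgFormula (Fin n) F)
    (hdeg : Φ.formalDegree ≤ n / 10)
    (hΦ : Φ.toPoly = MvPolynomial.esymm (Fin n) F (n / 10) + ∑ j, A j * B j + R) :
    (0.001 : ℝ) * (n : ℝ) ^ 2 ≤ (Φ.numVertices : ℝ) ∧
      (10 ≤ n → (0.001 : ℝ) * (n : ℝ) ^ 2 ≤ (Φ.numVarLeaves : ℝ)) := by
  have hleaves : 10 ≤ n → n ^ 2 ≤ 1000 * Φ.numVarLeaves := by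
    intro hn
    obtain ⟨d, hd⟩ : ∃ d, n / 10 = d + 1 := ⟨n / 10 - 1, by omega⟩
    rw [hd] at hr hR hdeg hΦ
    have hR' : R.totalDegree ≤ d := by
      rcases hR with rfl | hR
      · simp
      · omega
    -- For `d = 0` no `m ≥ 1` has `2 * m ≤ d + 1`, but then `n ≤ 19` and one leaf suffices.
    rcases Nat.eq_zero_or_pos d with rfl | hd0
    · have h1 := Φ.lt_formalDegree_of_toPoly_eq (by omega) A B R hA hB hR' hΦ
      have h2 := Φ.formalDegree_le_numVarLeaves
      have h3 : n ≤ 19 := by omega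
      nlinarith
    · obtain ⟨t, ht, hm⟩ := Φ.le_numVarLeaves_of_toPoly_eq (m := (d + 1) / 2) (by omega)
        (by omega) A B R hA hB hR' hdeg hΦ
      have h1 : 7 * n ≤ 20 * t := by omega
      have h2 : n ≤ 40 * ((d + 1) / 2) := by omega
      -- This gives `7 n² ≤ 800 t m`, stronger than needed.
      have h3 := Nat.mul_le_mul h1 h2
      nlinarith
  have hreal : ∀ N : ℕ, n ^ 2 ≤ 1000 * N → (0.001 : ℝ) * (n : ℝ) ^ 2 ≤ (N : ℝ) := by
    intro N hN
    have : (n : ℝ) ^ 2 ≤ 1000 * (N : ℝ) := by exact_mod_cast hN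
    linarith
  refine ⟨hreal _ ?_, fun hn => hreal _ (hleaves hn)⟩
  by_cases hn : 10 ≤ n
  · exact (hleaves hn).trans (Nat.mul_le_mul_left _ Φ.numVarLeaves_le_numVertices)
  · have := Φ.numVertices_pos
    nlinarith
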